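/- \textbf{Setting.} A Dyck word is a well-formed word $\sigma=\sigma(1)\dots\sigma(N)$ over $\{+,-\}$ ($+$ opening, $-$ closing bracket). Positions $i<j$ are \emph{matched} in $\sigma$ if $\sigma(i)={+}$, $\sigma(j)={-}$ and $\sigma(i+1)\dots\sigma(j-1)$ is a Dyck word. Suppose $\sigma={+}\tau{-}$ with $\tau$ a Dyck word. The \emph{rooted tree $D$ associated with $\sigma$} has the matched pairs as its nodes, and the parent of a node is the innermost matched pair that strictly encloses it; $D$ is \emph{binary} if every node has at most two children. A \emph{re-pairing} of $\sigma$ is a sequence of pairs $(\ell_1,r_1),\dots,(\ell_{N/2},r_{N/2})$ with $\ell_i<r_i$, $\sigma(\ell_i)={+}$, $\sigma(r_i)={-}$, such that every position in $\{1,\dots,N\}$ occurs in exactly one pair; it is \emph{simple} if every $(\ell_i,r_i)$ is matched in $\sigma$. Its \emph{width} is the maximum over $0\le t\le N/2$ of the smallest number of integer intervals whose union is $\{\ell_1,r_1,\dots,\ell_t,r_t\}$. \textbf{Statement.} There is an absolute constant $C$ such that the following holds for every Dyck word $\sigma={+}\tau{-}$ ($\tau$ a Dyck word) whose associated tree $D$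 is binary. Let $w$ be the minimum width of a simple re-pairing of $\sigma$, and let $h$ be the maximum height (number of edges on a longest root-to-leaf path) of a complete binary tree that is a minor of $D$ as an undirected graph (both exist). Then $h\le C\,w$, and if $D$ has at least three nodes, then also $w\le C\,h$. -/

import Mathlib

/-! Conventions: the opening bracket `+` is `DyckStep.U`, the closing bracket `-` is `DyckStep.D`, a
well-formed word `σ` is a `DyckWord`, and its positions are numbered from `0`. -/

/-- The width of a set `S` of integers: the smallest number of intervals
`[a, b] = {x ∈ ℤ | a ≤ x ≤ b}` whose union is `S`. -/
noncomputable def intervalWidth (S : Set ℤ) : ℕ :=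
  sInf {k : ℕ | ∃ I : Fin k → ℤ × ℤ, S = ⋃ i, Set.Icc (I i).1 (I i).2}

namespace DyckWord

/-- Positions in the word `σ`. -/
abbrev Pos (σ : DyckWord) : Type := Fin σ.toList.length

/-- The plus at position `i` and the minus at position `j` are matched to each other in `σ`: the
factor of `σ` from `i` to `j` has the form `+ w -` where `w` is a well-formed word. -/
def Matched (σ : DyckWord) (i j : σ.Pos) : Prop :=
  i < j ∧ σ.toList.get i = DyckStep.U ∧ σ.toList.get j = DyckStep.D ∧
    ∃ w : DyckWord, w.toList = (σ.toList.take j).drop (i + 1)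

/-- A re-pairing of `σ`: a sequence of `|σ| / 2` pairs of positions, each consisting of a plus and
of a minus to its right, such that every position occurs in exactly one pair of the sequence. -/
structure Repairing (σ : DyckWord) where
  pair : Fin σ.semilength → σ.Pos × σ.Pos
  left_plus : ∀ t, σ.toList.get (pair t).1 = DyckStep.U
  right_minus : ∀ t, σ.toList.get (pair t).2 = DyckStep.D
  left_lt_right : ∀ t, (pair t).1 < (pair t).2
  existsUnique : ∀ k : σ.Pos, ∃! t, (pair t).1 = k ∨ (pair t).2 = k

namespace Repairing

variable {σ : DyckWord}

/-- The set of positions (as integers) erased by the first `t` moves. -/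
def erased (p : σ.Repairing) (t : ℕ) : Set ℤ :=
  {b : ℤ | ∃ i : Fin σ.semilength, (i : ℕ) < t ∧
    (b = ((p.pair i).1 : ℕ) ∨ b = ((p.pair i).2 : ℕ))}

/-- The width of a re-pairing: the maximum over all times of the width of the erased set. -/
noncomputable def width (p : σ.Repairing) : ℕ :=
  (Finset.range (σ.semilength + 1)).sup fun t => intervalWidth (p.erased t)

/-- A re-pairing is simple if it always pairs two signs that are matched in the word. -/
def IsSimple (p : σ.Repairing) : Prop :=
  ∀ t, σ.Matched (p.pair t).1 (p.pair t).2

end Repairing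

/-- The nodes of the rooted forest associated with `σ`: the pairs of matched signs. -/
def Node (σ : DyckWord) : Type := {p : σ.Pos × σ.Pos // σ.Matched p.1 p.2}

/-- The pair `u` lies strictly inside the pair `v`. -/
def Node.IsDescendant {σ : DyckWord} (u v : σ.Node) : Prop :=
  v.1.1 < u.1.1 ∧ u.1.2 < v.1.2

/-- `u` is a child of `v`: the pair `v` is the innermost pair around `u`. Thus for a matched factor
`+ w -` the children of its node are the top-level matched pairs of `w`. -/
def Node.IsChild {σ : DyckWord} (u v : σ.Node) : Prop :=
  u.IsDescendant v ∧ ¬ ∃ x : σ.Node, u.IsDescendant x ∧ x.IsDescendant v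

/-- The (undirected) graph underlying the rooted forest associated with `σ`. It is a tree exactly if
`σ` has the form `+ w -` with `w` well-formed, which is `σ.IsNested`. -/
def treeGraph (σ : DyckWord) : SimpleGraph σ.Node :=
  SimpleGraph.fromRel fun u v => u.IsChild v

/-- Every node of the forest associated with `σ` has at most two children. -/
def IsBinary (σ : DyckWord) : Prop :=
  ∀ v : σ.Node, {u : σ.Node | u.IsChild v}.ncard ≤ 2

end DyckWord

/-- `H` is a minor of `G`: there are pairwise disjoint (nonempty) connected branch sets in `G`, one
for each vertex of `H`, such that adjacent vertices of `H` have branch sets joined by an edge. -/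
def SimpleGraph.IsMinorOf {W V : Type*} (H : SimpleGraph W) (G : SimpleGraph V) : Prop :=
  ∃ B : W → Set V, (∀ w, (G.induce (B w)).Connected) ∧
    (∀ w w', w ≠ w' → Disjoint (B w) (B w')) ∧
    ∀ w w', H.Adj w w' → ∃ x ∈ B w, ∃ y ∈ B w', G.Adj x y

/-- The complete binary tree of height `h`, where height is counted in edges: the nodes are the
binary strings of length at most `h`, and the children of `s` are `false :: s` and `true :: s`. -/
def completeBinaryTree (h : ℕ) : SimpleGraph {s : List Bool // s.length ≤ h} :=
  SimpleGraph.fromRel fun s t => ∃ b : Bool, t.1 = b :: s.1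

/-! Both bounds compare a simple re-pairing with the order in which it erases the nodes of `D`.

Bound on `h`. In a binary tree every child is the first or the last child of its parent, so each
edge of `D` has its ends at two neighbouring positions (`exists_gap`). An edge between an erased and
a surviving node thus gives a boundary point of the erased set, and a union of `w` intervals has at
most `2 * w` of these (`ncard_cut_le`). A complete binary tree minor forces a large cut in every
linear order: of three disjoint parts whose cuts peak at different times, take the one that peaks
second. At that time one of the other parts has an erased vertex and another has a surviving one,
and a path joining them outside the middle part adds an edge to its cut
(`Branching.exists_le_ncard_cut`). Three disjoint parts cost two levels of the tree, so `h / 2 ≤ 2 *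
w`.

Bound on `w`. Build an order and a minor together by recursion on subtrees, following the Strahler
number (`exists_isEnumeration`): erase first the child subtree of larger value, then the other, then
the root. A finished subtree is a single interval, so the value grows only when both children have
equal values, and exactly then the two minors join below a new root. This gives `w ≤ k + 1` for a
minor of height `k`; with three nodes `h ≥ 1` absorbs the additive one. -/

/-! ### Heights, matched pairs and their nesting -/

namespace DyckWord

/-- The height of the path of `σ` after `k` letters. -/
def height (σ : DyckWord) (k : ℕ) : ℤ :=
  ((σ.toList.take k).count DyckStep.U : ℤ) - (σ.toList.take k).count DyckStep.D

lemma height_zero (σ : DyckWord) : σ.height 0 = 0 := by simp [height]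

lemma height_length (σ : DyckWord) : σ.height σ.toList.length = 0 := by
  simp [height, σ.count_U_eq_count_D]

lemma height_nonneg (σ : DyckWord) (k : ℕ) : 0 ≤ σ.height k := by
  have := σ.count_D_le_count_U k
  simp only [height]; omega

lemma height_succ_of_U (σ : DyckWord) (i : σ.Pos) (h : σ.toList.get i = DyckStep.U) :
    σ.height (i + 1) = σ.height i + 1 := by
  have : σ.toList[(i : ℕ)] = DyckStep.U := h
  simp only [height, List.take_succ_eq_append_getElem i.2, List.count_append, this]
  simp; ring

lemma height_succ_of_D (σ : DyckWord) (i : σ.Pos) (h : σ.toList.get i = DyckStep.D) :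
    σ.height (i + 1) = σ.height i - 1 := by
  have : σ.toList[(i : ℕ)] = DyckStep.D := h
  simp only [height, List.take_succ_eq_append_getElem i.2, List.count_append, this]
  simp; ring

lemma get_eq_U_or_D (σ : DyckWord) (i : σ.Pos) :
    σ.toList.get i = DyckStep.U ∨ σ.toList.get i = DyckStep.D := by
  cases σ.toList.get i <;> simp

lemma _root_.List.count_take_drop_take {α : Type*} [DecidableEq α] (l : List α) (a : α)
    {i j : ℕ} (hij : i ≤ j) (m : ℕ) :
    ((((l.take j).drop i).take m).count a : ℤ)
      = (l.take (min (i + m) j)).count a - (l.take i).count a := by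
  have h1 : l.take (min (i + m) j) = l.take i ++ ((l.take j).drop i).take m := by
    have h2 := List.take_append_drop i (l.take (min (i + m) j))
    rw [List.take_take, min_eq_left (by omega)] at h2
    rw [← h2, List.take_drop, List.take_take]
  rw [h1, List.count_append]; push_cast; ring

/-- Letter counts in prefixes of the inner factor are differences of prefix counts of `σ`, so the
factor's own height is that of `σ` shifted by `σ.height (i + 1)`. -/
lemma matched_iff (σ : DyckWord) (i j : σ.Pos) :
    σ.Matched i j ↔ i < j ∧ σ.toList.get i = DyckStep.U ∧ σ.toList.get j = DyckStep.D ∧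
      σ.height j = σ.height (i + 1) ∧
      ∀ k : ℕ, (i : ℕ) + 1 ≤ k → k ≤ j → σ.height (i + 1) ≤ σ.height k := by
  unfold Matched
  constructor
  · rintro ⟨hij, hU, hD, w, hw⟩
    have hij' : (i : ℕ) + 1 ≤ j := hij
    have key : ∀ m, (σ.height (min (i + 1 + m) j) - σ.height (i + 1) : ℤ) = w.height m := by
      intro m
      simp only [height, hw, List.count_take_drop_take _ _ hij']
      ring
    refine ⟨hij, hU, hD, ?_, fun k hk1 hk2 => ?_⟩
    · have h1 := key w.toList.length
      have h2 : w.toList.length = j - (i + 1) := by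
        rw [hw]; simp
      rw [w.height_length, h2, min_eq_right (by omega)] at h1
      linarith
    · have h1 := key (k - (i + 1))
      rw [min_eq_left (by omega), show (i : ℕ) + 1 + (k - (i + 1)) = k by omega] at h1
      linarith [w.height_nonneg (k - (i + 1))]
  · rintro ⟨hij, hU, hD, h1, h2⟩
    have hij' : (i : ℕ) + 1 ≤ j := hij
    refine ⟨hij, hU, hD, ⟨(σ.toList.take j).drop (i + 1), ?_, fun m => ?_⟩, rfl⟩
    · have hU' := List.count_take_drop_take σ.toList DyckStep.U hij' j
      have hD' := List.count_take_drop_take σ.toList DyckStep.D hij' j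
      rw [List.take_of_length_le (by simp), min_eq_right (by omega)] at hU' hD'
      simp only [height] at h1
      omega
    · have hU' := List.count_take_drop_take σ.toList DyckStep.U hij' m
      have hD' := List.count_take_drop_take σ.toList DyckStep.D hij' m
      have := h2 (min (i + 1 + m) j) (by omega) (by omega)
      simp only [height] at this
      omega

instance (σ : DyckWord) : Finite σ.Node := Subtype.finite

namespace Node

variable {σ : DyckWord}

/-- The position of the opening bracket of a node. -/
abbrev left (u : σ.Node) : ℕ := u.1.1

/-- The position of the closing bracket of a node. -/
abbrev right (u : σ.Node) : ℕ := u.1.2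

lemma left_lt_right (u : σ.Node) : u.left < u.right := u.2.1

lemma left_get (u : σ.Node) : σ.toList.get u.1.1 = DyckStep.U := u.2.2.1

lemma right_get (u : σ.Node) : σ.toList.get u.1.2 = DyckStep.D := u.2.2.2.1

lemma left_ne_right (u v : σ.Node) : u.left ≠ v.right := fun h => by
  have := u.left_get
  rw [Fin.ext h, v.right_get] at this
  cases this

lemma height_right_succ (u : σ.Node) : σ.height (u.right + 1) = σ.height u.left := by
  have h := ((σ.matched_iff _ _).1 u.2).2.2.2.1
  rw [height_succ_of_U _ _ u.left_get] at h
  rw [height_succ_of_D _ _ u.right_get, h]; ring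

lemma height_lt (u : σ.Node) {k : ℕ} (h1 : u.left < k) (h2 : k ≤ u.right) :
    σ.height u.left < σ.height k := by
  have h := ((σ.matched_iff _ _).1 u.2).2.2.2.2 k h1 h2
  rw [height_succ_of_U _ _ u.left_get] at h
  exact Int.lt_of_add_one_le h

/-- Matched pairs do not cross: just after `u` closes the path is at height `σ.height u.left`, below
`σ.height v.left`, which is impossible while `v` is open or as it closes. -/
lemma right_lt_of_left_lt {u v : σ.Node} (h1 : u.left < v.left) (h2 : v.left ≤ u.right) :
    v.right < u.right := by
  have h3 := u.height_lt h1 h2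
  have hu := u.height_right_succ
  have hv := v.height_right_succ
  by_contra! h4
  rcases h4.eq_or_lt with h5 | h5
  · rw [h5] at hu; omega
  · have := v.height_lt (k := u.right + 1) (by omega) (by omega)
    omega

lemma ext_left {u v : σ.Node} (h : u.left = v.left) : u = v := by
  have hu := u.height_right_succ
  have hv := v.height_right_succ
  have := u.left_lt_right
  have := v.left_lt_right
  have hr : u.right = v.right := by
    rcases lt_trichotomy u.right v.right with h5 | h5 | h5
    · have := v.height_lt (k := u.right + 1) (by omega) (by omega)
      rw [h] at hu; omega
    · exact h5
    · have := u.height_lt (k := v.right + 1) (by omega) (by omega)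
      rw [h] at this; omega
  exact Subtype.ext (Prod.ext (Fin.ext h) (Fin.ext hr))

lemma ext_right {u v : σ.Node} (h : u.right = v.right) : u = v := by
  apply ext_left
  have := u.left_lt_right
  have := v.left_lt_right
  rcases lt_trichotomy u.left v.left with h5 | h5 | h5
  · have := right_lt_of_left_lt h5 (by omega); omega
  · exact h5
  · have := right_lt_of_left_lt h5 (by omega); omega

lemma isDescendant_iff {u v : σ.Node} :
    u.IsDescendant v ↔ v.left < u.left ∧ u.right < v.right := Iff.rfl

lemma IsDescendant.trans {u v w : σ.Node} (h : u.IsDescendant v) (h' : v.IsDescendant w) :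
    u.IsDescendant w := by
  rw [isDescendant_iff] at *; omega

lemma IsDescendant.ne {u v : σ.Node} (h : u.IsDescendant v) : u ≠ v := by
  rintro rfl
  rw [isDescendant_iff] at h; omega

/-- Two distinct nodes are either nested or separated. -/
lemma trichotomy (u v : σ.Node) :
    u = v ∨ u.IsDescendant v ∨ v.IsDescendant u ∨ u.right < v.left ∨ v.right < u.left := by
  simp only [isDescendant_iff]
  rcases lt_trichotomy u.left v.left with h | h | h
  · by_cases h2 : v.left ≤ u.right
    · have := right_lt_of_left_lt h h2; omega
    · omega
  · exact Or.inl (ext_left h)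
  · by_cases h2 : u.left ≤ v.right
    · have := right_lt_of_left_lt h h2; omega
    · omega

lemma IsDescendant.comparable {u v w : σ.Node} (h : u.IsDescendant v) (h' : u.IsDescendant w) :
    v = w ∨ v.IsDescendant w ∨ w.IsDescendant v := by
  have := trichotomy v w
  have := u.left_lt_right
  simp only [isDescendant_iff] at *
  rcases this with h | h | h | h | h
  all_goals first | exact Or.inl h | omega

end Node

/-- The partner is the letter that first brings the path back to its height before `i`. A return
exists because the height is `0` from the end of the word on. -/
lemma exists_node_of_U (σ : DyckWord) (i : σ.Pos) (h : σ.toList.get i = DyckStep.U) :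
    ∃ u : σ.Node, u.1.1 = i := by
  classical
  have hex : ∃ j : ℕ, (i : ℕ) < j ∧ σ.height (j + 1) ≤ σ.height i := by
    refine ⟨σ.toList.length, i.2, ?_⟩
    have h1 : σ.height (σ.toList.length + 1) = 0 := by
      rw [← σ.height_length]; simp [height, List.take_of_length_le]
    rw [h1]; exact σ.height_nonneg _
  obtain ⟨hj1, hj2⟩ := Nat.find_spec hex
  have hmin := fun k (hk : k < Nat.find hex) => Nat.find_min hex hk
  set j := Nat.find hex
  have hsucc := height_succ_of_U σ i h
  have hgt : ∀ k : ℕ, (i : ℕ) + 1 ≤ k → k ≤ j → σ.height (i + 1) ≤ σ.height k := by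
    intro k hk1 hk2
    rcases hk1.eq_or_lt with rfl | hk
    · exact le_rfl
    · have := hmin (k - 1) (by omega)
      rw [show k - 1 + 1 = k by omega] at this
      have h3 : ¬ σ.height k ≤ σ.height i := fun h4 => this ⟨by omega, h4⟩
      omega
  have hjj := hgt j (by omega) le_rfl
  have hjN : j < σ.toList.length := by
    by_contra! hN
    have := σ.height_nonneg i
    have h0 : σ.height j = 0 := by
      rw [← σ.height_length]; simp [height, List.take_of_length_le hN]
    omega
  have hD : σ.toList.get ⟨j, hjN⟩ = DyckStep.D := by
    rcases σ.get_eq_U_or_D ⟨j, hjN⟩ with h4 | h4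
    · have := σ.height_succ_of_U _ h4
      simp only at this
      omega
    · exact h4
  have := σ.height_succ_of_D _ hD
  simp only at this
  exact ⟨⟨(i, ⟨j, hjN⟩), (σ.matched_iff _ _).2 ⟨hj1, h, hD, by simp only; omega, hgt⟩⟩, rfl⟩

/-- The partner starts at the last time up to `j` when the path is no higher than it is right after
`j`. -/
lemma exists_node_of_D (σ : DyckWord) (j : σ.Pos) (h : σ.toList.get j = DyckStep.D) :
    ∃ u : σ.Node, u.1.2 = j := by
  classical
  have hsucc := height_succ_of_D σ j h
  have hpos := σ.height_nonneg (j + 1)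
  let P : ℕ → Prop := fun i => σ.height i ≤ σ.height (j + 1)
  have hP0 : P 0 := by simp only [P, height_zero]; exact hpos
  have h1 : P (Nat.findGreatest P j) := Nat.findGreatest_spec (Nat.zero_le _) hP0
  have h2 : Nat.findGreatest P j ≤ j := Nat.findGreatest_le _
  have h3 := fun k (hk : Nat.findGreatest P j < k) (hk' : k ≤ j) =>
    Nat.findGreatest_is_greatest hk hk'
  set i := Nat.findGreatest P j
  simp only [P] at h1 h3
  have hij : i < j := by
    rcases h2.eq_or_lt with h4 | h4
    · rw [h4] at h1; omega
    · exact h4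
  have hU : σ.toList.get ⟨i, hij.trans j.2⟩ = DyckStep.U := by
    rcases σ.get_eq_U_or_D ⟨i, hij.trans j.2⟩ with h4 | h4
    · exact h4
    · have := σ.height_succ_of_D _ h4
      have := h3 (i + 1) (by omega) hij
      simp only at *
      omega
  have hs := σ.height_succ_of_U _ hU
  have hs' := h3 (i + 1) (by omega) hij
  simp only at hs
  refine ⟨⟨(⟨i, hij.trans j.2⟩, j), (σ.matched_iff _ _).2 ⟨hij, hU, h, by simp only; omega, ?_⟩⟩, rfl⟩
  intro k hk1 hk2
  have := h3 k (by simp only at hk1; omega) hk2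
  simp only
  omega

lemma exists_node (σ : DyckWord) {k : ℕ} (hk : k < σ.toList.length) :
    ∃ u : σ.Node, u.left = k ∨ u.right = k := by
  rcases σ.get_eq_U_or_D ⟨k, hk⟩ with h | h
  · obtain ⟨u, hu⟩ := σ.exists_node_of_U _ h
    exact ⟨u, Or.inl (congrArg Fin.val hu)⟩
  · obtain ⟨u, hu⟩ := σ.exists_node_of_D _ h
    exact ⟨u, Or.inr (congrArg Fin.val hu)⟩

namespace Node

variable {σ : DyckWord}

/-- The node owning a position inside `v` is `v` or a descendant of `v`. -/
lemma eq_or_isDescendant_of_mem {u v : σ.Node} {k : ℕ} (hk : u.left = k ∨ u.right = k)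
    (h1 : v.left ≤ k) (h2 : k ≤ v.right) : u = v ∨ u.IsDescendant v := by
  have hu := u.left_lt_right
  have hv := v.left_lt_right
  rcases trichotomy u v with h | h | h | h | h
  · exact Or.inl h
  · exact Or.inr h
  · rw [isDescendant_iff] at h; omega
  · omega
  · omega

lemma exists_isChild_of_isDescendant {u v : σ.Node} (h : u.IsDescendant v) :
    ∃ c : σ.Node, c.IsChild v ∧ (u = c ∨ u.IsDescendant c) := by
  -- The outermost node on the way from `u` up to `v` is the one that opens first.
  obtain ⟨c, ⟨hc1, hc2⟩, hmin⟩ := Set.exists_min_image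
    {c : σ.Node | c.IsDescendant v ∧ (u = c ∨ u.IsDescendant c)} Node.left (Set.toFinite _)
    ⟨u, h, Or.inl rfl⟩
  refine ⟨c, ⟨hc1, ?_⟩, hc2⟩
  rintro ⟨x, hx1, hx2⟩
  have := hmin x ⟨hx2, Or.inr ?_⟩
  · rw [isDescendant_iff] at hx1; omega
  · rcases hc2 with rfl | hc2
    · exact hx1
    · exact hc2.trans hx1

lemma exists_isChild_parent {u v : σ.Node} (h : u.IsDescendant v) :
    ∃ p : σ.Node, u.IsChild p := by
  obtain ⟨p, hp, hmax⟩ := Set.exists_max_image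
    {p : σ.Node | u.IsDescendant p} Node.left (Set.toFinite _) ⟨v, h⟩
  refine ⟨p, hp, ?_⟩
  rintro ⟨x, hx1, hx2⟩
  have := hmax x hx1
  rw [isDescendant_iff] at hx2; omega

/-- Distinct children of a node are separated. -/
lemma IsChild.separated {a b v : σ.Node} (ha : a.IsChild v) (hb : b.IsChild v) (hab : a ≠ b) :
    a.right < b.left ∨ b.right < a.left := by
  rcases trichotomy a b with h | h | h | h | h
  · exact (hab h).elim
  · exact (ha.2 ⟨b, h, hb.1⟩).elim
  · exact (hb.2 ⟨a, h, ha.1⟩).elim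
  · exact Or.inl h
  · exact Or.inr h

lemma exists_isChild_at {v : σ.Node} {k : ℕ} (h1 : v.left < k) (h2 : k < v.right) :
    ∃ c : σ.Node, c.IsChild v ∧ c.left ≤ k ∧ k ≤ c.right := by
  obtain ⟨u, hu⟩ := σ.exists_node (h2.trans v.1.2.2)
  have hur := u.left_lt_right
  obtain ⟨c, hc, hc'⟩ : ∃ c : σ.Node, c.IsChild v ∧ (u = c ∨ u.IsDescendant c) := by
    apply exists_isChild_of_isDescendant
    rcases eq_or_isDescendant_of_mem hu h1.le h2.le with rfl | h
    · omega
    · exact h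
  refine ⟨c, hc, ?_⟩
  rcases hc' with rfl | h
  · omega
  · rw [isDescendant_iff] at h; omega

/-- In a binary forest each child is the first or the last child of its parent. -/
lemma IsChild.first_or_last (hσ : σ.IsBinary) {c v : σ.Node} (h : c.IsChild v) :
    v.left + 1 = c.left ∨ c.right + 1 = v.right := by
  by_contra! hne
  have hd := isDescendant_iff.1 h.1
  have hc := c.left_lt_right
  -- The children owning the two extreme positions inside `v`, together with a middle child `c`,
  -- would be three distinct children.
  obtain ⟨a, ha, ha1, ha2⟩ := exists_isChild_at (v := v) (k := v.left + 1) (by omega) (by omega)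
  obtain ⟨b, hb, hb1, hb2⟩ := exists_isChild_at (v := v) (k := v.right - 1) (by omega) (by omega)
  have hda := isDescendant_iff.1 ha.1
  have hdb := isDescendant_iff.1 hb.1
  have hac : a ≠ c := by rintro rfl; omega
  have hbc : b ≠ c := by rintro rfl; omega
  have hab : a ≠ b := by
    rintro rfl
    have := ha.separated h hac
    omega
  have h3 : ({a, b, c} : Set σ.Node).ncard = 3 := by
    rw [Set.ncard_eq_three]; exact ⟨a, b, c, hab, hac, hbc, rfl⟩
  have h4 : ({a, b, c} : Set σ.Node).ncard ≤ {u : σ.Node | u.IsChild v}.ncard := by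
    apply Set.ncard_le_ncard
    · rintro x (rfl | rfl | rfl) <;> assumption
    · exact Set.toFinite _
  have := hσ v
  omega

end Node

/-- If the first bracket closed before the end, the path would touch height `0` in the interior,
which nestedness forbids. -/
lemma IsNested.exists_root {σ : DyckWord} (h : σ.IsNested) :
    ∃ v : σ.Node, v.left = 0 ∧ v.right + 1 = σ.toList.length := by
  have hne := toList_ne_nil.2 h.1
  have hpos : 0 < σ.toList.length := List.length_pos_iff.2 hne
  have hU : σ.toList.get ⟨0, hpos⟩ = DyckStep.U := by
    have := σ.head_eq_U hne
    rwa [List.head_eq_getElem] at this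
  obtain ⟨v, hv⟩ := σ.exists_node_of_U _ hU
  have hv0 : v.left = 0 := congrArg Fin.val hv
  refine ⟨v, hv0, ?_⟩
  by_contra hlt
  have hr : v.right < σ.toList.length := v.1.2.2
  have h1 := h.2 (i := v.right + 1) (by omega) (by omega)
  have h2 := v.height_right_succ
  rw [hv0, height_zero] at h2
  simp only [height] at h2
  omega

lemma Node.eq_or_isDescendant_root {σ : DyckWord} {v : σ.Node} (h0 : v.left = 0)
    (h1 : v.right + 1 = σ.toList.length) (u : σ.Node) : u = v ∨ u.IsDescendant v := by
  have := u.1.1.2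
  exact eq_or_isDescendant_of_mem (Or.inl rfl) (by omega) (by simp only [left]; omega)

lemma treeGraph_adj {σ : DyckWord} {u v : σ.Node} :
    σ.treeGraph.Adj u v ↔ u.IsChild v ∨ v.IsChild u := by
  simp only [treeGraph, SimpleGraph.fromRel_adj, and_iff_right_iff_imp]
  rintro (h | h)
  · exact h.1.ne
  · exact h.1.ne.symm

/-- Each position is one end of exactly one node, so `σ.Node × Bool` is in bijection with the
positions. -/
lemma card_node (σ : DyckWord) : Nat.card σ.Node = σ.semilength := by
  let f : σ.Node × Bool → σ.Pos := fun p => if p.2 then p.1.1.1 else p.1.1.2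
  have hf : f.Bijective := by
    constructor
    · rintro ⟨u, a⟩ ⟨v, b⟩ h
      have h' := congrArg Fin.val h
      cases a <;> cases b <;> simp only [f] at h'
      · rw [Node.ext_right h']
      · exact (v.left_ne_right u h'.symm).elim
      · exact (u.left_ne_right v h').elim
      · rw [Node.ext_left h']
    · intro k
      obtain ⟨u, hu | hu⟩ := σ.exists_node k.2
      · exact ⟨(u, true), Fin.ext hu⟩
      · exact ⟨(u, false), Fin.ext hu⟩
  have h := Nat.card_congr (Equiv.ofBijective f hf)
  rw [Nat.card_prod] at h
  have h2 := σ.two_mul_semilength_eq_length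
  simp at h
  omega

end DyckWord

/-! ### Unions of integer intervals -/

/-- `S` is a union of `n` (possibly empty) integer intervals. -/
def IsUnionOfIntervals (n : ℕ) (S : Set ℤ) : Prop :=
  ∃ I : Fin n → ℤ × ℤ, S = ⋃ i, Set.Icc (I i).1 (I i).2

namespace IsUnionOfIntervals

lemma intervalWidth_le {n : ℕ} {S : Set ℤ} (h : IsUnionOfIntervals n S) : intervalWidth S ≤ n :=
  Nat.sInf_le h

/-- The hypothesis excludes the default value `sInf ∅ = 0`. -/
lemma of_intervalWidth {n : ℕ} {S : Set ℤ} (h : IsUnionOfIntervals n S) :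
    IsUnionOfIntervals (intervalWidth S) S :=
  Nat.sInf_mem (s := {k | IsUnionOfIntervals k S}) ⟨n, h⟩

lemma empty (n : ℕ) : IsUnionOfIntervals n ∅ := ⟨fun _ => (1, 0), by simp⟩

lemma icc (a b : ℤ) : IsUnionOfIntervals 1 (Set.Icc a b) := ⟨fun _ => (a, b), (Set.iUnion_const _).symm⟩

lemma union {m n : ℕ} {S T : Set ℤ} (hS : IsUnionOfIntervals m S) (hT : IsUnionOfIntervals n T) :
    IsUnionOfIntervals (m + n) (S ∪ T) := by
  obtain ⟨I, rfl⟩ := hS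
  obtain ⟨J, rfl⟩ := hT
  refine ⟨Fin.append I J, ?_⟩
  ext x
  simp only [Set.mem_union, Set.mem_iUnion]
  constructor
  · rintro (⟨i, hi⟩ | ⟨i, hi⟩)
    · exact ⟨Fin.castAdd n i, by simpa using hi⟩
    · exact ⟨Fin.natAdd m i, by simpa using hi⟩
  · rintro ⟨i, hi⟩
    induction i using Fin.addCases with
    | left i => exact Or.inl ⟨i, by simpa using hi⟩
    | right i => exact Or.inr ⟨i, by simpa using hi⟩

lemma mono {m n : ℕ} {S : Set ℤ} (hS : IsUnionOfIntervals m S) (hmn : m ≤ n) :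
    IsUnionOfIntervals n S := by
  obtain ⟨k, rfl⟩ := Nat.exists_eq_add_of_le hmn
  simpa using hS.union (empty k)

lemma exists_of_finite {S : Set ℤ} (hS : S.Finite) : ∃ n, IsUnionOfIntervals n S := by
  induction S, hS using Set.Finite.induction_on with
  | empty => exact ⟨0, empty 0⟩
  | @insert a S _ _ ih =>
    obtain ⟨n, hn⟩ := ih
    exact ⟨1 + n, by rw [Set.insert_eq, ← Set.Icc_self]; exact (icc a a).union hn⟩

/-- A union of `n` intervals has at most `2 * n` boundary points. -/
lemma ncard_boundary_le {n : ℕ} {S : Set ℤ} (h : IsUnionOfIntervals n S) :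
    {i : ℤ | ¬ (i ∈ S ↔ i + 1 ∈ S)}.Finite ∧ {i : ℤ | ¬ (i ∈ S ↔ i + 1 ∈ S)}.ncard ≤ 2 * n := by
  obtain ⟨I, rfl⟩ := h
  -- Membership can change only just after a right end or just before a left end.
  let g : Fin n ⊕ Fin n → ℤ := Sum.elim (fun i => (I i).2) (fun i => (I i).1 - 1)
  have hsub : {i : ℤ | ¬ (i ∈ ⋃ i, Set.Icc (I i).1 (I i).2 ↔ i + 1 ∈ ⋃ i, Set.Icc (I i).1 (I i).2)}
      ⊆ Set.range g := by
    intro x hx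
    simp only [Set.mem_iUnion, Set.mem_Icc, Set.mem_ofPred_eq] at hx
    by_cases h1 : ∃ i, (I i).1 ≤ x ∧ x ≤ (I i).2
    · obtain ⟨i, hi⟩ := h1
      refine ⟨Sum.inl i, ?_⟩
      have : ¬ ((I i).1 ≤ x + 1 ∧ x + 1 ≤ (I i).2) := fun h => hx ⟨fun _ => ⟨i, h⟩, fun _ => ⟨i, hi⟩⟩
      simp only [g, Sum.elim_inl]
      omega
    · have h2 : ∃ i, (I i).1 ≤ x + 1 ∧ x + 1 ≤ (I i).2 := by
        by_contra h2
        exact hx ⟨fun h => (h1 h).elim, fun h => (h2 h).elim⟩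
      obtain ⟨i, hi⟩ := h2
      refine ⟨Sum.inr i, ?_⟩
      have : ¬ ((I i).1 ≤ x ∧ x ≤ (I i).2) := fun h => h1 ⟨i, h⟩
      simp only [g, Sum.elim_inr]
      omega
  refine ⟨(Set.finite_range g).subset hsub, ?_⟩
  refine (Set.ncard_le_ncard hsub (Set.finite_range g)).trans ?_
  rw [← Set.image_univ]
  refine (Set.ncard_image_le Set.finite_univ).trans ?_
  simp [Set.ncard_univ, two_mul]

end IsUnionOfIntervals

/-! ### Large cuts forced by complete binary tree minors -/

namespace SimpleGraph

variable {V : Type*} (G : SimpleGraph V)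

/-- `S` contains, recursively to depth `k`, three disjoint sets none of which disconnects `S`. -/
def Branching : ℕ → Set V → Prop
  | 0, S => S.Nonempty
  | k + 1, S => ∃ T : Fin 3 → Set V,
      (∀ i, T i ⊆ S ∧ Branching k (T i) ∧ (G.induce (S \ T i)).Preconnected) ∧
      ∀ i j, i ≠ j → Disjoint (T i) (T j)

/-- The edges of `G` inside `S` that leave the initial segment `{v | f v ≤ n}`. -/
def cut (f : V → ℕ) (n : ℕ) (S : Set V) : Set (V × V) :=
  {q | q.1 ∈ S ∧ q.2 ∈ S ∧ G.Adj q.1 q.2 ∧ f q.1 ≤ n ∧ n < f q.2}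

variable {G}

lemma cut_nonempty {f : V → ℕ} {n : ℕ} {S : Set V} (hS : (G.induce S).Preconnected) {a b : V}
    (ha : a ∈ S) (hb : b ∈ S) (han : f a ≤ n) (hbn : n < f b) : (G.cut f n S).Nonempty := by
  obtain ⟨p⟩ := hS ⟨a, ha⟩ ⟨b, hb⟩
  obtain ⟨d, -, h1, h2⟩ := p.exists_boundary_dart {x | f x ≤ n} han (by simpa using hbn)
  exact ⟨(d.fst, d.snd), d.fst.2, d.snd.2, d.adj, h1, by simpa using h2⟩

lemma exists_increasing_triple {g : Fin 3 → ℕ} (hg : g.Injective) :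
    ∃ a b c, a ≠ b ∧ b ≠ c ∧ g a < g b ∧ g b < g c := by
  have h01 := hg.ne (show (0 : Fin 3) ≠ 1 by decide)
  have h02 := hg.ne (show (0 : Fin 3) ≠ 2 by decide)
  have h12 := hg.ne (show (1 : Fin 3) ≠ 2 by decide)
  rcases h01.lt_or_gt with h | h <;> rcases h02.lt_or_gt with h' | h' <;>
    rcases h12.lt_or_gt with h'' | h''
  all_goals first
    | exact ⟨0, 1, 2, by decide, by decide, by omega, by omega⟩
    | exact ⟨0, 2, 1, by decide, by decide, by omega, by omega⟩
    | exact ⟨1, 0, 2, by decide, by decide, by omega, by omega⟩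
    | exact ⟨1, 2, 0, by decide, by decide, by omega, by omega⟩
    | exact ⟨2, 0, 1, by decide, by decide, by omega, by omega⟩
    | exact ⟨2, 1, 0, by decide, by decide, by omega, by omega⟩

/-- In every linear order of the vertices some initial segment has a large cut. -/
lemma Branching.exists_le_ncard_cut [Finite V] {f : V → ℕ} (hf : f.Injective) {k : ℕ} {S : Set V}
    (hS : G.Branching k S) : ∃ v ∈ S, k ≤ (G.cut f (f v) S).ncard := by
  induction k generalizing S with
  | zero =>
    obtain ⟨v, hv⟩ := hS
    exact ⟨v, hv, Nat.zero_le _⟩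
  | succ k ih =>
    obtain ⟨T, hT, hdisj⟩ := hS
    choose v hvT hvk using fun i => ih (hT i).2.1
    have hinj : (fun i => f (v i)).Injective := by
      intro i j hij
      by_contra hne
      exact Set.disjoint_left.1 (hdisj i j hne) (hvT i) (hf hij ▸ hvT j)
    -- Cut at the middle peak `v b`: `v a` is already in the initial segment, `v c` is not, and both
    -- lie outside `T b`.
    obtain ⟨a, b, c, hab, hbc, h1, h2⟩ := exists_increasing_triple hinj
    refine ⟨v b, (hT b).1 (hvT b), ?_⟩
    have hmem : ∀ i, i ≠ b → v i ∈ S \ T b := fun i hi =>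
      ⟨(hT i).1 (hvT i), Set.disjoint_left.1 (hdisj i b hi) (hvT i)⟩
    obtain ⟨q, hq⟩ := cut_nonempty (hT b).2.2 (hmem a hab) (hmem c hbc.symm) h1.le h2
    -- The crossing edge avoids `T b`, so it is new.
    have hq' : q ∉ G.cut f (f (v b)) (T b) := fun h => hq.1.2 h.1
    calc k + 1 ≤ (G.cut f (f (v b)) (T b)).ncard + 1 := Nat.add_le_add_right (hvk b) 1
      _ = (insert q (G.cut f (f (v b)) (T b))).ncard :=
        (Set.ncard_insert_of_notMem hq' (Set.toFinite _)).symm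
      _ ≤ _ := by
        refine Set.ncard_le_ncard ?_ (Set.toFinite _)
        rintro x (rfl | hx)
        · exact ⟨hq.1.1, hq.2.1.1, hq.2.2⟩
        · exact ⟨(hT b).1 hx.1, (hT b).1 hx.2.1, hx.2.2⟩

/-- The part of a minor model below the node `s`. -/
def below {h : ℕ} (B : {s : List Bool // s.length ≤ h} → Set V) (s : List Bool) : Set V :=
  {x | ∃ u, s <:+ u.1 ∧ x ∈ B u}

lemma Reachable.induce_mono {A X : Set V} (hAX : A ⊆ X) {a b : A}
    (hab : (G.induce A).Reachable a b) :
    (G.induce X).Reachable ⟨a, hAX a.2⟩ ⟨b, hAX b.2⟩ :=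
  hab.map (G.induceHomOfLE hAX).toHom

/-- Strings grow at the head, so ancestors are suffixes. Going up from a string not below `t` never
enters the part below `t`, hence every remaining branch set is linked to that of `s`. -/
lemma below_diff_preconnected {h : ℕ} {B : {s : List Bool // s.length ≤ h} → Set V}
    (hconn : ∀ w, (G.induce (B w)).Connected)
    (hdisj : ∀ w w', w ≠ w' → Disjoint (B w) (B w'))
    (hadj : ∀ w w', (completeBinaryTree h).Adj w w' → ∃ x ∈ B w, ∃ y ∈ B w', G.Adj x y)
    {s t : List Bool} (hs : s.length ≤ h) (hts : ¬ t <:+ s) :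
    (G.induce (below B s \ below B t)).Preconnected := by
  have hsub : ∀ u : {s : List Bool // s.length ≤ h}, s <:+ u.1 → ¬ t <:+ u.1 →
      B u ⊆ below B s \ below B t := by
    rintro u hsu htu x hx
    refine ⟨⟨u, hsu, hx⟩, ?_⟩
    rintro ⟨u', hu', hx'⟩
    by_cases huu : u = u'
    · exact htu (huu ▸ hu')
    · exact Set.disjoint_left.1 (hdisj u u' huu) hx hx'
  have hs0 := hsub ⟨s, hs⟩ List.suffix_rfl hts
  obtain ⟨y₀, hy₀⟩ := (hconn ⟨s, hs⟩).nonempty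
  have key : ∀ (r : List Bool) (hr : (r ++ s).length ≤ h) (htr : ¬ t <:+ r ++ s) (x : V)
      (hx : x ∈ B ⟨r ++ s, hr⟩), (G.induce (below B s \ below B t)).Reachable
        ⟨x, hsub ⟨r ++ s, hr⟩ (List.suffix_append _ _) htr hx⟩ ⟨y₀, hs0 hy₀⟩ := by
    intro r
    induction r with
    | nil =>
      intro hr htr x hx
      exact Reachable.induce_mono hs0 ((hconn ⟨s, hs⟩).preconnected ⟨x, hx⟩ ⟨y₀, hy₀⟩)
    | cons b r ih =>
      intro hr htr x hx
      have hr' : (r ++ s).length ≤ h := by simp at hr ⊢; omega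
      have htr' : ¬ t <:+ r ++ s := fun h' => htr (h'.trans (List.suffix_cons b _))
      obtain ⟨y, hy, z, hz, hyz⟩ := hadj ⟨r ++ s, hr'⟩ ⟨b :: r ++ s, hr⟩ (by
        rw [completeBinaryTree, fromRel_adj]
        refine ⟨fun heq => ?_, Or.inl ⟨b, rfl⟩⟩
        have := congrArg (fun l => l.1.length) heq
        simp at this)
      have hsubu := hsub ⟨b :: r ++ s, hr⟩ (List.suffix_append _ _) htr
      have h1 := Reachable.induce_mono hsubu
        ((hconn ⟨b :: r ++ s, hr⟩).preconnected ⟨x, hx⟩ ⟨z, hz⟩)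
      have h2 : (G.induce (below B s \ below B t)).Adj ⟨z, hsubu hz⟩
          ⟨y, hsub ⟨r ++ s, hr'⟩ (List.suffix_append _ _) htr' hy⟩ := hyz.symm
      exact (h1.trans h2.reachable).trans (ih hr' htr' y hy)
  have key' : ∀ x : ↥(below B s \ below B t),
      (G.induce (below B s \ below B t)).Reachable x ⟨y₀, hs0 hy₀⟩ := by
    rintro ⟨x, ⟨⟨u, hu⟩, ⟨r, hr⟩, hx⟩, hxt⟩
    simp only at hr
    subst hr
    exact key r hu (fun h' => hxt ⟨_, h', hx⟩) x hx
  exact fun x y => (key' x).trans (key' y).symm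

/-- Two children are too few for `Branching`; three of the four grandchildren serve, at a price of
two levels per step. -/
lemma branching_below {h : ℕ} {B : {s : List Bool // s.length ≤ h} → Set V}
    (hconn : ∀ w, (G.induce (B w)).Connected)
    (hdisj : ∀ w w', w ≠ w' → Disjoint (B w) (B w'))
    (hadj : ∀ w w', (completeBinaryTree h).Adj w w' → ∃ x ∈ B w, ∃ y ∈ B w', G.Adj x y)
    {k : ℕ} {s : List Bool} (hs : s.length + 2 * k ≤ h) : G.Branching k (below B s) := by
  induction k generalizing s with
  | zero =>
    obtain ⟨x, hx⟩ := (hconn ⟨s, by omega⟩).nonempty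
    exact ⟨x, _, List.suffix_rfl, hx⟩
  | succ k ih =>
    let t : Fin 3 → List Bool :=
      ![false :: false :: s, true :: false :: s, false :: true :: s]
    have hlen : ∀ i, (t i).length = s.length + 2 := by
      intro i; fin_cases i <;> rfl
    have hst : ∀ i, s <:+ t i := by
      intro i
      fin_cases i <;> exact (List.suffix_cons _ _).trans (List.suffix_cons _ _)
    have hinj : t.Injective := by
      intro i j hij
      fin_cases i <;> fin_cases j <;> simp [t] at hij ⊢
    refine ⟨fun i => below B (t i), fun i => ⟨?_, ih (by rw [hlen]; omega), ?_⟩, ?_⟩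
    · rintro x ⟨u, hu, hx⟩
      exact ⟨u, (hst i).trans hu, hx⟩
    · refine below_diff_preconnected hconn hdisj hadj (by omega) fun h' => ?_
      have := h'.length_le
      rw [hlen] at this; omega
    · intro i j hij
      rw [Set.disjoint_left]
      rintro x ⟨u, hu, hx⟩ ⟨u', hu', hx'⟩
      by_cases huu : u = u'
      · subst huu
        have h1 := List.suffix_of_suffix_length_le hu hu' (by rw [hlen, hlen])
        exact hij (hinj (h1.eq_of_length (by rw [hlen, hlen])))
      · exact Set.disjoint_left.1 (hdisj u u' huu) hx hx'

end SimpleGraph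

/-! ### Minor height is at most linear in width -/

namespace DyckWord

variable {σ : DyckWord}

/-- The positions occupied by the nodes of `S`. -/
def positions (S : Set σ.Node) : Set ℤ :=
  {b | ∃ u ∈ S, b = (u.left : ℤ) ∨ b = (u.right : ℤ)}

lemma Node.eq_of_owns {u v : σ.Node} {k : ℕ} (hu : u.left = k ∨ u.right = k)
    (hv : v.left = k ∨ v.right = k) : u = v := by
  rcases hu with hu | hu <;> rcases hv with hv | hv
  · exact ext_left (hu.trans hv.symm)
  · exact (left_ne_right u v (hu.trans hv.symm)).elim
  · exact (left_ne_right v u (hv.trans hu.symm)).elim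
  · exact ext_right (hu.trans hv.symm)

lemma mem_positions {S : Set σ.Node} {u : σ.Node} {k : ℕ} (hu : u.left = k ∨ u.right = k) :
    (k : ℤ) ∈ positions S ↔ u ∈ S := by
  constructor
  · rintro ⟨v, hv, hk⟩
    have hv' : v.left = k ∨ v.right = k := by omega
    rwa [Node.eq_of_owns hu hv']
  · exact fun h => ⟨u, h, by omega⟩

lemma finite_positions (S : Set σ.Node) : (positions S).Finite := by
  have : positions S ⊆ (fun u : σ.Node => (u.left : ℤ)) '' S ∪ (fun u => (u.right : ℤ)) '' S := by
    rintro b ⟨u, hu, h | h⟩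
    · exact Or.inl ⟨u, hu, h.symm⟩
    · exact Or.inr ⟨u, hu, h.symm⟩
  exact (((Set.toFinite S).image _).union ((Set.toFinite S).image _)).subset this

/-- The ends of an edge of the tree occupy two adjacent positions. -/
lemma exists_gap (hσ : σ.IsBinary) {x y : σ.Node} (h : σ.treeGraph.Adj x y) :
    ∃ i : ℕ, ((x.left = i ∨ x.right = i) ∧ (y.left = i + 1 ∨ y.right = i + 1)) ∨
      ((y.left = i ∨ y.right = i) ∧ (x.left = i + 1 ∨ x.right = i + 1)) := by
  rcases treeGraph_adj.1 h with h | h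
  · rcases h.first_or_last hσ with h' | h'
    · exact ⟨y.left, by omega⟩
    · exact ⟨x.right, by omega⟩
  · rcases h.first_or_last hσ with h' | h'
    · exact ⟨x.left, by omega⟩
    · exact ⟨y.right, by omega⟩

/-- Send each cut edge to a gap between neighbouring positions owned by its two ends; exactly one
side of the gap is erased, so it is a boundary point. -/
lemma ncard_cut_le (hσ : σ.IsBinary) (f : σ.Node → ℕ) (n : ℕ) (S : Set σ.Node) :
    (σ.treeGraph.cut f n S).ncard ≤ 2 * intervalWidth (positions {u | f u ≤ n}) := by
  obtain ⟨m, hm⟩ := IsUnionOfIntervals.exists_of_finite (finite_positions {u : σ.Node | f u ≤ n})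
  obtain ⟨hfin, hle⟩ := hm.of_intervalWidth.ncard_boundary_le
  refine le_trans ?_ hle
  have hex : ∀ q : σ.Node × σ.Node, ∃ i : ℕ, q ∈ σ.treeGraph.cut f n S →
      ((q.1.left = i ∨ q.1.right = i) ∧ (q.2.left = i + 1 ∨ q.2.right = i + 1)) ∨
      ((q.2.left = i ∨ q.2.right = i) ∧ (q.1.left = i + 1 ∨ q.1.right = i + 1)) := by
    intro q
    by_cases hq : q ∈ σ.treeGraph.cut f n S
    · obtain ⟨i, hi⟩ := exists_gap hσ hq.2.2.1
      exact ⟨i, fun _ => hi⟩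
    · exact ⟨0, fun h => (hq h).elim⟩
  choose g hg using hex
  refine Set.ncard_le_ncard_of_injOn (fun q => (g q : ℤ)) ?_ ?_ hfin
  · intro q hq
    have h1 : q.1 ∈ {u : σ.Node | f u ≤ n} := hq.2.2.2.1
    have h2 : q.2 ∉ {u : σ.Node | f u ≤ n} := by simpa using hq.2.2.2.2
    simp only [Set.mem_ofPred_eq (p := fun i : ℤ => ¬ (i ∈ positions _ ↔ i + 1 ∈ positions _))]
    rcases hg q hq with ⟨ha, hb⟩ | ⟨ha, hb⟩
    · rw [mem_positions ha, ← Nat.cast_succ, mem_positions hb]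
      exact fun h => h2 (h.1 h1)
    · rw [mem_positions ha, ← Nat.cast_succ, mem_positions hb]
      exact fun h => h2 (h.2 h1)
  -- The gap determines the two end nodes, and the time `n` determines which of them comes first in
  -- the pair.
  · intro q hq q' hq' hqq
    have hgg : g q = g q' := by simpa using hqq
    have h1 := hg q hq
    have h2 := hg q' hq'
    rw [← hgg] at h2
    have hlt := hq.2.2.2
    have hlt' := hq'.2.2.2
    rcases h1 with ⟨ha, hb⟩ | ⟨ha, hb⟩ <;> rcases h2 with ⟨ha', hb'⟩ | ⟨ha', hb'⟩
    · exact Prod.ext (Node.eq_of_owns ha ha') (Node.eq_of_owns hb hb')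
    · have := Node.eq_of_owns ha ha'
      rw [this] at hlt; omega
    · have := Node.eq_of_owns ha ha'
      rw [this] at hlt; omega
    · exact Prod.ext (Node.eq_of_owns hb hb') (Node.eq_of_owns ha ha')

/-- A simple re-pairing erases the nodes one by one, in the order given by some function. -/
lemma Repairing.IsSimple.exists_order {p : σ.Repairing} (hp : p.IsSimple) :
    ∃ f : σ.Node → ℕ, f.Injective ∧ (∀ u, f u < σ.semilength) ∧
      ∀ n, p.erased (n + 1) = positions {u | f u ≤ n} := by
  have hex : ∀ u : σ.Node, ∃ t, p.pair t = u.1 := by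
    intro u
    -- The move erasing the opening bracket of `u` pairs it with its match, hence is `u` itself.
    obtain ⟨t, ht, -⟩ := p.existsUnique u.1.1
    have ht' : (p.pair t).1 = u.1.1 := by
      rcases ht with ht | ht
      · exact ht
      · have := p.right_minus t
        rw [ht, u.left_get] at this
        cases this
    exact ⟨t, congrArg Subtype.val
      (Node.ext_left (u := ⟨p.pair t, hp t⟩) (v := u) (congrArg Fin.val ht'))⟩
  choose g hg using hex
  have hgsurj : ∀ t, g ⟨p.pair t, hp t⟩ = t := by
    intro t
    have h := hg ⟨p.pair t, hp t⟩
    exact (p.existsUnique (p.pair t).1).unique (Or.inl (congrArg Prod.fst h)) (Or.inl rfl)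
  refine ⟨fun u => g u, fun u v huv => ?_, fun u => (g u).2, fun n => ?_⟩
  · apply Subtype.ext
    rw [← hg u, ← hg v, Fin.ext huv]
  · ext b
    constructor
    · rintro ⟨t, ht, hb⟩
      refine ⟨⟨p.pair t, hp t⟩, ?_, hb⟩
      change (g ⟨p.pair t, hp t⟩ : ℕ) ≤ n
      rw [hgsurj]; exact Nat.le_of_lt_succ ht
    · rintro ⟨u, hu, hb⟩
      refine ⟨g u, Nat.lt_succ_of_le hu, ?_⟩
      rw [hg]; exact hb

lemma Repairing.le_width {p : σ.Repairing} {t : ℕ} (ht : t ≤ σ.semilength) :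
    intervalWidth (p.erased t) ≤ p.width :=
  Finset.le_sup (f := fun t => intervalWidth (p.erased t))
    (Finset.mem_range.2 (Nat.lt_succ_of_le ht))

/-- A nonempty erased set needs an interval. This later absorbs the additive constant in the bound
on `h`. -/
lemma Repairing.IsSimple.one_le_width {p : σ.Repairing} (hp : p.IsSimple) (u : σ.Node) :
    1 ≤ p.width := by
  obtain ⟨f, -, hlt, hf⟩ := hp.exists_order
  refine le_trans ?_ (le_width (p := p) (t := f u + 1) (hlt u))
  rw [hf]
  obtain ⟨m, hm⟩ := IsUnionOfIntervals.exists_of_finite (finite_positions {v : σ.Node | f v ≤ f u})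
  have hm' := hm.of_intervalWidth
  by_contra! h0
  rw [Nat.lt_one_iff.1 h0] at hm'
  obtain ⟨I, hI⟩ := hm'
  have : (u.left : ℤ) ∈ positions {v : σ.Node | f v ≤ f u} := ⟨u, le_refl (f u), Or.inl rfl⟩
  rw [hI] at this
  simp at this

/-- The height of a complete binary tree minor is linear in the width of every simple
re-pairing. -/
lemma Repairing.IsSimple.height_le_width (hσ : σ.IsBinary) {p : σ.Repairing} (hp : p.IsSimple)
    {h : ℕ} (hh : (completeBinaryTree h).IsMinorOf σ.treeGraph) : h ≤ 4 * p.width + 1 := by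
  obtain ⟨B, h1, h2, h3⟩ := hh
  obtain ⟨f, hinj, hlt, hf⟩ := hp.exists_order
  -- Rounding in `h / 2` is the source of the `+ 1`.
  have hB : σ.treeGraph.Branching (h / 2) (SimpleGraph.below B []) :=
    SimpleGraph.branching_below h1 h2 h3 (by simp; omega)
  obtain ⟨v, -, hv⟩ := hB.exists_le_ncard_cut hinj
  have h4 := ncard_cut_le hσ f (f v) (SimpleGraph.below B [])
  rw [← hf] at h4
  have h5 := le_width (p := p) (t := f v + 1) (hlt v)
  omega

end DyckWord

/-! ### Building rooted complete binary tree minors -/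

namespace SimpleGraph

variable {V : Type*} {G : SimpleGraph V}

/-- `G` has a complete binary tree of height `k` as a minor inside `S`, the branch set of the root
containing `v`. -/
def HasRootedBinaryMinor (G : SimpleGraph V) (k : ℕ) (S : Set V) (v : V) : Prop :=
  ∃ B : List Bool → Set V,
    (∀ s, s.length ≤ k → B s ⊆ S ∧ (G.induce (B s)).Connected) ∧
    (∀ s t, s.length ≤ k → t.length ≤ k → s ≠ t → Disjoint (B s) (B t)) ∧
    (∀ s b, s.length < k → ∃ x ∈ B s, ∃ y ∈ B (b :: s), G.Adj x y) ∧ v ∈ B []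

namespace HasRootedBinaryMinor

lemma isMinorOf {k : ℕ} {S : Set V} {v : V} (h : G.HasRootedBinaryMinor k S v) :
    (completeBinaryTree k).IsMinorOf G := by
  obtain ⟨B, h1, h2, h3, -⟩ := h
  refine ⟨fun s => B s.1, fun s => (h1 s.1 s.2).2,
    fun s t hst => h2 _ _ s.2 t.2 fun h => hst (Subtype.ext h), ?_⟩
  rintro ⟨s, hs⟩ ⟨t, ht⟩ hst
  rw [completeBinaryTree, fromRel_adj] at hst
  obtain ⟨-, ⟨b, hb⟩ | ⟨b, hb⟩⟩ := hst
  · simp only at hb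
    subst hb
    exact h3 s b ht
  · simp only at hb
    subst hb
    obtain ⟨x, hx, y, hy, hxy⟩ := h3 t b hs
    exact ⟨y, hy, x, hx, hxy.symm⟩

lemma connected_singleton (G : SimpleGraph V) (v : V) :
    (G.induce ({v} : Set V)).Connected := by
  have : Nonempty ({v} : Set V) := ⟨⟨v, rfl⟩⟩
  refine ⟨?_⟩
  rintro ⟨x, rfl⟩ ⟨y, rfl⟩
  exact Reachable.refl _

lemma zero (G : SimpleGraph V) (v : V) : G.HasRootedBinaryMinor 0 {v} v := by
  refine ⟨fun _ => {v}, fun s _ => ⟨subset_rfl, connected_singleton G v⟩, ?_, ?_, rfl⟩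
  · intro s t hs ht hst
    rw [Nat.le_zero, List.length_eq_zero_iff] at hs ht
    exact (hst (hs.trans ht.symm)).elim
  · intro s b hs
    exact absurd hs (Nat.not_lt_zero _)

lemma mono {k : ℕ} {S T : Set V} {v : V} (h : G.HasRootedBinaryMinor k S v) (hST : S ⊆ T) :
    G.HasRootedBinaryMinor k T v := by
  obtain ⟨B, h1, h2⟩ := h
  exact ⟨B, fun s hs => ⟨(h1 s hs).1.trans hST, (h1 s hs).2⟩, h2⟩

/-- The root branch set can be extended to a neighbour outside. -/
lemma extend {k : ℕ} {S : Set V} {a v : V} (h : G.HasRootedBinaryMinor k S a) (hva : G.Adj v a)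
    (hv : v ∉ S) : G.HasRootedBinaryMinor k (insert v S) v := by
  obtain ⟨B, h1, h2, h3, h4⟩ := h
  have hsub : ∀ s, s.length ≤ k → B s ⊆ S := fun s hs => (h1 s hs).1
  have hle : ∀ s, B s ⊆ if s = [] then insert v (B s) else B s := by
    intro s
    split_ifs
    · exact Set.subset_insert _ _
    · exact subset_rfl
  refine ⟨fun s => if s = [] then insert v (B s) else B s, ?_, ?_, ?_, ?_⟩
  · intro s hs
    beta_reduce
    by_cases h0 : s = []
    · subst h0
      refine ⟨by rw [if_pos rfl]; exact Set.insert_subset_insert (hsub _ hs), ?_⟩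
      -- Two connected sets that meet in `a`.
      have heq : insert v (B []) = {v, a} ∪ B [] := by
        rw [Set.insert_union, Set.singleton_union, Set.insert_eq_of_mem h4]
      rw [if_pos rfl, heq]
      exact induce_union_connected (induce_pair_connected_of_adj hva).preconnected
        (h1 _ hs).2.preconnected ⟨a, by simp, h4⟩
    · rw [if_neg h0]
      exact ⟨(hsub s hs).trans (Set.subset_insert _ _), (h1 s hs).2⟩
  · intro s t hs ht hst
    have := h2 s t hs ht hst
    have hvs : v ∉ B s := fun h => hv (hsub s hs h)
    have hvt : v ∉ B t := fun h => hv (hsub t ht h)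
    dsimp only
    split_ifs with h0 h0' h0'
    · exact (hst (h0.trans h0'.symm)).elim
    · exact Set.disjoint_insert_left.2 ⟨hvt, this⟩
    · exact Set.disjoint_insert_right.2 ⟨hvs, this⟩
    · exact this
  · intro s b hs
    obtain ⟨x, hx, y, hy, hxy⟩ := h3 s b hs
    exact ⟨x, hle _ hx, y, hle _ hy, hxy⟩
  · simp

/-- Two minors below a new root are joined to a minor of larger height. -/
lemma join {k : ℕ} {S T : Set V} {a b v : V} (ha : G.HasRootedBinaryMinor k S a)
    (hb : G.HasRootedBinaryMinor k T b) (hST : Disjoint S T) (hva : G.Adj v a) (hvb : G.Adj v b)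
    (hvS : v ∉ S) (hvT : v ∉ T) : G.HasRootedBinaryMinor (k + 1) (insert v (S ∪ T)) v := by
  obtain ⟨A, a1, a2, a3, a4⟩ := ha
  obtain ⟨B, b1, b2, b3, b4⟩ := hb
  -- The last letter is the first step away from the root, so it selects the minor to use.
  let F : List Bool → Set V := fun s => match s.reverse with
    | [] => {v}
    | false :: r => A r.reverse
    | true :: r => B r.reverse
  have F0 : F [] = {v} := rfl
  have FA : ∀ s, F (s ++ [false]) = A s := by intro s; simp [F]
  have FB : ∀ s, F (s ++ [true]) = B s := by intro s; simp [F]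
  have cases : ∀ s : List Bool, s = [] ∨ (∃ r, s = r ++ [false]) ∨ ∃ r, s = r ++ [true] := by
    intro s
    rcases List.eq_nil_or_concat s with h | ⟨r, c, h⟩
    · exact Or.inl h
    · rw [List.concat_eq_append] at h
      cases c
      · exact Or.inr (Or.inl ⟨r, h⟩)
      · exact Or.inr (Or.inr ⟨r, h⟩)
  refine ⟨F, ?_, ?_, ?_, ?_⟩
  · intro s hs
    rcases cases s with rfl | ⟨r, rfl⟩ | ⟨r, rfl⟩
    · rw [F0]
      exact ⟨Set.singleton_subset_iff.2 (Set.mem_insert _ _), connected_singleton G v⟩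
    · have hr : r.length ≤ k := by simpa using hs
      rw [FA]
      exact ⟨(a1 r hr).1.trans (Set.subset_union_left.trans (Set.subset_insert _ _)), (a1 r hr).2⟩
    · have hr : r.length ≤ k := by simpa using hs
      rw [FB]
      exact ⟨(b1 r hr).1.trans (Set.subset_union_right.trans (Set.subset_insert _ _)), (b1 r hr).2⟩
  · intro s t hs ht hst
    rcases cases s with rfl | ⟨r, rfl⟩ | ⟨r, rfl⟩ <;>
      rcases cases t with rfl | ⟨q, rfl⟩ | ⟨q, rfl⟩
    all_goals
      try have hr : r.length ≤ k := by simpa using hs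
      try have hq : q.length ≤ k := by simpa using ht
      simp only [F0, FA, FB, Set.disjoint_singleton_left, Set.disjoint_singleton_right]
    · exact (hst rfl).elim
    · exact fun h => hvS ((a1 q hq).1 h)
    · exact fun h => hvT ((b1 q hq).1 h)
    · exact fun h => hvS ((a1 r hr).1 h)
    · exact a2 r q hr hq fun h => hst (h ▸ rfl)
    · exact hST.mono (a1 r hr).1 (b1 q hq).1
    · exact fun h => hvT ((b1 r hr).1 h)
    · exact hST.symm.mono (b1 r hr).1 (a1 q hq).1
    · exact b2 r q hr hq fun h => hst (h ▸ rfl)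
  · intro s c hs
    rcases cases s with rfl | ⟨r, rfl⟩ | ⟨r, rfl⟩
    · cases c
      · exact ⟨v, rfl, a, by rw [← List.nil_append [false], FA]; exact a4, hva⟩
      · exact ⟨v, rfl, b, by rw [← List.nil_append [true], FB]; exact b4, hvb⟩
    · rw [← List.cons_append, FA, FA]
      exact a3 r c (by simpa using hs)
    · rw [← List.cons_append, FB, FB]
      exact b3 r c (by simpa using hs)
  · rw [F0]; rfl

lemma of_path {a v b : V} (hva : G.Adj v a) (hvb : G.Adj v b) (hab : a ≠ b) :
    (completeBinaryTree 1).IsMinorOf G :=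
  (join (zero G a) (zero G b) (by simpa using hab) hva hvb (by simpa using hva.ne)
    (by simpa using hvb.ne)).isMinorOf

end HasRootedBinaryMinor

end SimpleGraph

/-! ### Narrow enumerations of subtrees -/

namespace DyckWord

variable {σ : DyckWord}

open SimpleGraph

lemma positions_union (S T : Set σ.Node) :
    positions (S ∪ T) = positions S ∪ positions T := by
  ext b
  constructor
  · rintro ⟨u, hu | hu, hb⟩
    · exact Or.inl ⟨u, hu, hb⟩
    · exact Or.inr ⟨u, hu, hb⟩
  · rintro (⟨u, hu, hb⟩ | ⟨u, hu, hb⟩)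
    · exact ⟨u, Or.inl hu, hb⟩
    · exact ⟨u, Or.inr hu, hb⟩

namespace Node

/-- The nodes of the subtree of `v`. -/
def subtree (v : σ.Node) : Set σ.Node := {u | u = v ∨ u.IsDescendant v}

lemma mem_subtree {u v : σ.Node} : u ∈ v.subtree ↔ u = v ∨ u.IsDescendant v := Iff.rfl

/-- Every position between the brackets of `v` belongs to a node, which by nesting lies in the
subtree. Hence a finished subtree costs only one interval. -/
lemma positions_subtree (v : σ.Node) : positions v.subtree = Set.Icc (v.left : ℤ) v.right := by
  ext b
  have hv := v.left_lt_right
  constructor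
  · rintro ⟨u, rfl | hu, hb⟩
    · rw [Set.mem_Icc]; omega
    · rw [isDescendant_iff] at hu
      have := u.left_lt_right
      rw [Set.mem_Icc]; omega
  · intro hb
    rw [Set.mem_Icc] at hb
    lift b to ℕ using by omega
    have h2 : b ≤ v.right := by omega
    obtain ⟨u, hu⟩ := σ.exists_node (h2.trans_lt v.1.2.2)
    rw [mem_positions hu]
    exact eq_or_isDescendant_of_mem hu (by omega) h2

lemma subtree_subset {u v : σ.Node} (h : u.IsDescendant v) : u.subtree ⊆ v.subtree := by
  rintro x (rfl | hx)
  · exact Or.inr h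
  · exact Or.inr (hx.trans h)

lemma IsDescendant.notMem_subtree {u v : σ.Node} (h : u.IsDescendant v) : v ∉ u.subtree := by
  rintro (h' | h')
  · exact h.ne h'.symm
  · exact (h.trans h').ne rfl

lemma IsChild.disjoint_subtree {a b v : σ.Node} (ha : a.IsChild v) (hb : b.IsChild v)
    (hab : a ≠ b) : Disjoint a.subtree b.subtree := by
  rw [Set.disjoint_left]
  intro x hxa hxb
  have h := ha.separated hb hab
  have hx := x.left_lt_right
  have h1 : a.left ≤ x.left ∧ x.right ≤ a.right := by
    rcases hxa with rfl | h
    · exact ⟨le_rfl, le_rfl⟩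
    · exact ⟨h.1.le, h.2.le⟩
  have h2 : b.left ≤ x.left ∧ x.right ≤ b.right := by
    rcases hxb with rfl | h
    · exact ⟨le_rfl, le_rfl⟩
    · exact ⟨h.1.le, h.2.le⟩
  omega

/-- The list `L` enumerates the subtree of `v`, and each of its initial segments occupies at most
`k` intervals. -/
structure IsEnumeration (k : ℕ) (v : σ.Node) (L : List σ.Node) : Prop where
  nodup : L.Nodup
  mem_iff : ∀ u, u ∈ L ↔ u ∈ v.subtree
  take : ∀ m, IsUnionOfIntervals k (positions {u | u ∈ L.take m})

lemma IsEnumeration.setOf_mem {k : ℕ} {v : σ.Node} {L : List σ.Node} (h : IsEnumeration k v L) :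
    {u | u ∈ L} = v.subtree := Set.ext h.mem_iff

lemma setOf_mem_take_append (L M : List σ.Node) (m : ℕ) :
    {u | u ∈ (L ++ M).take m} = {u | u ∈ L.take m} ∪ {u | u ∈ M.take (m - L.length)} := by
  ext u
  simp [List.take_append]

lemma isEnumeration_of_leaf {v : σ.Node} (hv : ∀ u : σ.Node, ¬ u.IsChild v) :
    IsEnumeration 1 v [v] := by
  have hsub : v.subtree = {v} := by
    ext u
    constructor
    · rintro (rfl | h)
      · rfl
      · obtain ⟨c, hc, -⟩ := exists_isChild_of_isDescendant h
        exact (hv c hc).elim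
    · rintro rfl
      exact Or.inl rfl
  refine ⟨List.nodup_singleton v, fun u => by rw [hsub]; simp, fun m => ?_⟩
  cases m with
  | zero =>
    convert IsUnionOfIntervals.empty 1
    ext b
    simp [positions]
  | succ m =>
    have : {u | u ∈ [v].take (m + 1)} = v.subtree := by rw [hsub]; ext u; simp
    rw [this, positions_subtree]
    exact IsUnionOfIntervals.icc _ _

/-- Appending `v` to a list of all its descendants. -/
lemma isEnumeration_append_root {k : ℕ} (hk : 1 ≤ k) {v : σ.Node} {L : List σ.Node}
    (hL : L.Nodup) (hmem : ∀ u, u ∈ L ↔ u.IsDescendant v)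
    (htake : ∀ m, IsUnionOfIntervals k (positions {u | u ∈ L.take m})) :
    IsEnumeration k v (L ++ [v]) := by
  have hmem' : ∀ u, u ∈ L ++ [v] ↔ u ∈ v.subtree := by
    intro u
    rw [List.mem_append, hmem, List.mem_singleton, mem_subtree, or_comm]
  refine ⟨?_, hmem', fun m => ?_⟩
  · rw [List.nodup_append]
    refine ⟨hL, List.nodup_singleton v, ?_⟩
    intro x hx y hy
    rw [List.mem_singleton] at hy
    rw [hy]
    exact ((hmem x).1 hx).ne
  · by_cases hm : m ≤ L.length
    · rw [List.take_append_of_le_length hm]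
      exact htake m
    -- Once `v` is included the whole subtree is erased, and one interval suffices.
    · rw [List.take_of_length_le (by simp; omega)]
      have : {u | u ∈ L ++ [v]} = v.subtree := Set.ext hmem'
      rw [this, positions_subtree]
      exact (IsUnionOfIntervals.icc _ _).mono hk

lemma IsEnumeration.of_one_child {k : ℕ} (hk : 1 ≤ k) {a v : σ.Node} {L : List σ.Node}
    (h : IsEnumeration k a L) (ha : ∀ u, u.IsChild v ↔ u = a) :
    IsEnumeration k v (L ++ [v]) := by
  refine isEnumeration_append_root hk h.nodup (fun u => ?_) h.take
  rw [h.mem_iff]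
  have hav := (ha a).2 rfl
  constructor
  · rintro (rfl | hu)
    · exact hav.1
    · exact hu.trans hav.1
  · intro hu
    obtain ⟨c, hc, hc'⟩ := exists_isChild_of_isDescendant hu
    rwa [(ha c).1 hc] at hc'

/-- While `b` is being processed, the finished subtree of `a` adds one interval to the at most `l`
of `M`. The child done first may use the full budget `k`. -/
lemma IsEnumeration.of_two_children {k l : ℕ} {a b v : σ.Node} {L M : List σ.Node}
    (hL : IsEnumeration k a L) (hM : IsEnumeration l b M) (hlk : l + 1 ≤ k) (hab : a ≠ b)
    (h : ∀ u, u.IsChild v ↔ u = a ∨ u = b) : IsEnumeration k v (L ++ M ++ [v]) := by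
  have ha := (h a).2 (Or.inl rfl)
  have hb := (h b).2 (Or.inr rfl)
  refine isEnumeration_append_root (by omega) ?_ (fun u => ?_) fun m => ?_
  · rw [List.nodup_append]
    refine ⟨hL.nodup, hM.nodup, ?_⟩
    rintro x hx y hy rfl
    exact Set.disjoint_left.1 (ha.disjoint_subtree hb hab) ((hL.mem_iff x).1 hx)
      ((hM.mem_iff x).1 hy)
  · rw [List.mem_append, hL.mem_iff, hM.mem_iff]
    constructor
    · rintro ((rfl | hu) | (rfl | hu))
      · exact ha.1
      · exact hu.trans ha.1
      · exact hb.1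
      · exact hu.trans hb.1
    · intro hu
      obtain ⟨c, hc, hc'⟩ := exists_isChild_of_isDescendant hu
      rcases (h c).1 hc with rfl | rfl
      · exact Or.inl hc'
      · exact Or.inr hc'
  · by_cases hm : m ≤ L.length
    · rw [List.take_append_of_le_length hm]
      exact hL.take m
    · rw [setOf_mem_take_append, positions_union, List.take_of_length_le (by omega), hL.setOf_mem,
        positions_subtree]
      exact ((IsUnionOfIntervals.icc _ _).union (hM.take _)).mono (by omega)

/-- The subtree of a node has a narrow enumeration and a tall complete binary tree minor. -/
theorem exists_isEnumeration (hσ : σ.IsBinary) (v : σ.Node) :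
    ∃ k L, IsEnumeration (k + 1) v L ∧ σ.treeGraph.HasRootedBinaryMinor k v.subtree v := by
  induction hn : v.right - v.left using Nat.strong_induction_on generalizing v with
  | _ n ih =>
  have ih' : ∀ a : σ.Node, a.IsChild v → ∃ k L, IsEnumeration (k + 1) a L ∧
      σ.treeGraph.HasRootedBinaryMinor k a.subtree a := by
    intro a ha
    have h := isDescendant_iff.1 ha.1
    have := a.left_lt_right
    exact ih _ (by omega) a rfl
  have hself : {v} ⊆ v.subtree := Set.singleton_subset_iff.2 (Or.inl rfl)
  have hins : ∀ a : σ.Node, a.IsChild v → insert v a.subtree ⊆ v.subtree := fun a ha =>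
    Set.insert_subset (Or.inl rfl) (subtree_subset ha.1)
  have hcard := hσ v
  have hcases : {u : σ.Node | u.IsChild v}.ncard = 0 ∨ {u : σ.Node | u.IsChild v}.ncard = 1 ∨
      {u : σ.Node | u.IsChild v}.ncard = 2 := by omega
  rcases hcases with h0 | h1 | h2
  · rw [Set.ncard_eq_zero (Set.toFinite _)] at h0
    exact ⟨0, [v], isEnumeration_of_leaf fun u hu => Set.eq_empty_iff_forall_notMem.1 h0 u hu,
      (HasRootedBinaryMinor.zero _ v).mono hself⟩
  · obtain ⟨a, ha⟩ := Set.ncard_eq_one.1 h1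
    have ha' : ∀ u, u.IsChild v ↔ u = a := fun u => Set.ext_iff.1 ha u
    have hav := (ha' a).2 rfl
    obtain ⟨k, L, hL, hk⟩ := ih' a hav
    exact ⟨k, _, hL.of_one_child (by omega) ha',
      (hk.extend (treeGraph_adj.2 (Or.inr hav)) hav.1.notMem_subtree).mono (hins a hav)⟩
  · obtain ⟨a, b, hab, hc⟩ := Set.ncard_eq_two.1 h2
    have hc' : ∀ u, u.IsChild v ↔ u = a ∨ u = b := fun u => Set.ext_iff.1 hc u
    have ha := (hc' a).2 (Or.inl rfl)
    have hb := (hc' b).2 (Or.inr rfl)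
    obtain ⟨k, L, hL, hk⟩ := ih' a ha
    obtain ⟨l, M, hM, hl⟩ := ih' b hb
    -- With unequal values the larger child goes first and the spare interval is free; with equal
    -- values the budget and the minor's height both increase by one.
    rcases lt_trichotomy k l with hkl | rfl | hkl
    · exact ⟨l, _, hM.of_two_children hL (by omega) hab.symm fun u => (hc' u).trans or_comm,
        (hl.extend (treeGraph_adj.2 (Or.inr hb)) hb.1.notMem_subtree).mono (hins b hb)⟩
    · refine ⟨k + 1, _, IsEnumeration.of_two_children (k := k + 2)
        ⟨hL.nodup, hL.mem_iff, fun m => (hL.take m).mono (by omega)⟩ hM le_rfl hab hc',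
        (hk.join hl (ha.disjoint_subtree hb hab) (treeGraph_adj.2 (Or.inr ha))
          (treeGraph_adj.2 (Or.inr hb)) ha.1.notMem_subtree hb.1.notMem_subtree).mono ?_⟩
      exact Set.insert_subset (Or.inl rfl)
        (Set.union_subset (subtree_subset ha.1) (subtree_subset hb.1))
    · exact ⟨k, _, hL.of_two_children hM (by omega) hab hc',
        (hk.extend (treeGraph_adj.2 (Or.inr ha)) ha.1.notMem_subtree).mono (hins a ha)⟩

end Node

/-! ### From enumerations to re-pairings, and the conclusion -/

/-- An enumeration of all nodes is a simple re-pairing. -/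
lemma exists_isSimple_of_list {k : ℕ} {L : List σ.Node} (hL : L.Nodup) (hmem : ∀ u, u ∈ L)
    (htake : ∀ m, IsUnionOfIntervals k (positions {u | u ∈ L.take m})) :
    ∃ p : σ.Repairing, p.IsSimple ∧ p.width ≤ k := by
  classical
  have hlen : L.length = σ.semilength := by
    rw [← σ.card_node, ← Set.ncard_univ, ← List.toFinset_card_of_nodup hL,
      ← Set.ncard_coe_finset]
    congr 1
    ext u
    simp [hmem]
  let g : Fin σ.semilength → σ.Node := fun t => L[(t : ℕ)]'(by rw [hlen]; exact t.2)
  have hg : ∀ u, ∃ t, g t = u := by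
    intro u
    obtain ⟨i, hi, h⟩ := List.getElem_of_mem (hmem u)
    exact ⟨⟨i, by rwa [← hlen]⟩, h⟩
  have hinj : g.Injective := by
    intro s t hst
    exact Fin.ext ((hL.getElem_inj_iff).1 hst)
  let p : σ.Repairing :=
    { pair := fun t => (g t).1
      left_plus := fun t => (g t).left_get
      right_minus := fun t => (g t).right_get
      left_lt_right := fun t => (g t).2.1
      existsUnique := by
        intro k
        obtain ⟨u, hu⟩ := σ.exists_node k.2
        obtain ⟨t, rfl⟩ := hg u
        refine ⟨t, by simpa only [Fin.ext_iff] using hu, fun s hs => hinj ?_⟩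
        exact Node.eq_of_owns (k := k) (by simpa only [Fin.ext_iff] using hs) hu }
  refine ⟨p, fun t => (g t).2, Finset.sup_le fun m _ => ?_⟩
  have h : p.erased m = positions {u | u ∈ L.take m} := by
    ext b
    constructor
    · rintro ⟨i, hi, hb⟩
      exact ⟨g i, List.mem_take_iff_getElem.2 ⟨i, by rw [hlen]; exact lt_min hi i.2, rfl⟩, hb⟩
    · rintro ⟨u, hu, hb⟩
      obtain ⟨i, hi, rfl⟩ := List.mem_take_iff_getElem.1 hu
      rw [hlen] at hi
      exact ⟨⟨i, (lt_min_iff.1 hi).2⟩, (lt_min_iff.1 hi).1, hb⟩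
  rw [h]
  exact (htake m).intervalWidth_le

/-- A tree with at least three nodes has a complete binary tree of height one as a minor. -/
lemma isMinorOf_one (hσ : σ.IsNested) (h3 : 3 ≤ σ.semilength) :
    (completeBinaryTree 1).IsMinorOf σ.treeGraph := by
  obtain ⟨r, hr0, hr1⟩ := hσ.exists_root
  have hroot := Node.eq_or_isDescendant_root hr0 hr1
  have hpar : ∀ u, u ≠ r → ∃ p : σ.Node, u.IsChild p := fun u hu =>
    Node.exists_isChild_parent ((hroot u).resolve_left hu)
  have hcard : 2 < (Set.univ : Set σ.Node).ncard := by
    rw [Set.ncard_univ, card_node]; omega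
  obtain ⟨x, y, hxr, hyr, hxy⟩ : ∃ x y : σ.Node, x ≠ r ∧ y ≠ r ∧ x ≠ y := by
    have h1 : 1 < ((Set.univ : Set σ.Node) \ {r}).ncard := by
      rw [Set.ncard_sdiff_singleton_of_mem (Set.mem_univ r)]; omega
    obtain ⟨x, y, hx, hy, hxy⟩ := (Set.one_lt_ncard_iff (Set.toFinite _)).1 h1
    exact ⟨x, y, hx.2, hy.2, hxy⟩
  -- A path with two edges suffices: either some node has a grandparent, or two nodes are children
  -- of the root.
  have path : ∀ u p : σ.Node, u.IsChild p → p ≠ r → (completeBinaryTree 1).IsMinorOf σ.treeGraph := by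
    intro u p hup hpr
    obtain ⟨q, hq⟩ := hpar p hpr
    exact HasRootedBinaryMinor.of_path (treeGraph_adj.2 (Or.inr hup)) (treeGraph_adj.2 (Or.inl hq))
      (hup.1.trans hq.1).ne
  obtain ⟨p, hp⟩ := hpar x hxr
  obtain ⟨q, hq⟩ := hpar y hyr
  by_cases hpr : p = r
  · by_cases hqr : q = r
    · subst hpr
      subst hqr
      exact HasRootedBinaryMinor.of_path (treeGraph_adj.2 (Or.inr hp))
        (treeGraph_adj.2 (Or.inr hq)) hxy
    · exact path y q hq hqr
  · exact path x p hp hpr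

end DyckWord

theorem mainTheorem8 :
    ∃ C : ℕ, ∀ σ : DyckWord, σ.IsNested → σ.IsBinary →
      ∃ w h : ℕ,
        IsLeast {k : ℕ | ∃ p : σ.Repairing, p.IsSimple ∧ p.width = k} w ∧
        IsGreatest {k : ℕ | (completeBinaryTree k).IsMinorOf σ.treeGraph} h ∧
        h ≤ C * w ∧
        (3 ≤ σ.semilength → w ≤ C * h) := by
  -- From `h ≤ 4 * w + 1` and `1 ≤ w`; in the other direction `w ≤ k + 1 ≤ h + 1 ≤ 2 * h` already
  -- suffices.
  refine ⟨5, fun σ hn hσ => ?_⟩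
  obtain ⟨r, hr0, hr1⟩ := hn.exists_root
  have hroot := DyckWord.Node.eq_or_isDescendant_root hr0 hr1
  obtain ⟨k, L, hL, hk⟩ := DyckWord.Node.exists_isEnumeration hσ r
  obtain ⟨p, hp, hpk⟩ := DyckWord.exists_isSimple_of_list hL.nodup
    (fun u => (hL.mem_iff u).2 (hroot u)) hL.take
  have hw := Nat.sInf_mem (s := {k : ℕ | ∃ p : σ.Repairing, p.IsSimple ∧ p.width = k})
    ⟨_, p, hp, rfl⟩
  have hwle : ∀ m ∈ {k : ℕ | ∃ p : σ.Repairing, p.IsSimple ∧ p.width = k},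
      sInf {k : ℕ | ∃ p : σ.Repairing, p.IsSimple ∧ p.width = k} ≤ m := fun m hm => Nat.sInf_le hm
  -- The width of any one simple re-pairing bounds all minors, so the maximum exists.
  have hbdd : BddAbove {k : ℕ | (completeBinaryTree k).IsMinorOf σ.treeGraph} :=
    ⟨_, fun m hm => hp.height_le_width hσ hm⟩
  have hh := Nat.sSup_mem ⟨k, hk.isMinorOf⟩ hbdd
  refine ⟨_, _, ⟨hw, hwle⟩, ⟨hh, fun m hm => le_csSup hbdd hm⟩, ?_, fun h3 => ?_⟩
  · obtain ⟨q, hq, hqw⟩ := hw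
    rw [← hqw]
    have h1 := hq.height_le_width hσ hh
    have h2 := hq.one_le_width r
    omega
  · have h1 := hwle _ ⟨p, hp, rfl⟩
    have h2 := le_csSup hbdd hk.isMinorOf
    have h4 := le_csSup hbdd (DyckWord.isMinorOf_one hn h3)
    omega
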